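/- Let $\overline{E}=(E,\Vert\cdot\Vert)$ be a Euclidean lattice of positive rank $n$, that is, a lattice $E$ (a discrete subgroup spanning the space over $\mathbb{R}$) in an $n$-dimensional real vector space $E_{\mathbb{R}}$ equipped with a Euclidean norm $\Vert\cdot\Vert$. Let $$R_{\mathrm{cov}}(\overline{E}) := \min\{r\ge 0 \mid \forall x\in E_{\mathbb{R}},\ \exists e\in E,\ \Vert x-e\Vert\le r\}$$ be its covering radius. Let $\overline{E}^\vee$ be the dual Euclidean lattice, whose elements are the linear forms on $E_{\mathbb{R}}$ that are integer-valued on $E$, with the dual norm $\Vert\cdot\Vert^\vee$, and let $$\lambda_1(\overline{E}^\vee) := \min_{\xi\in E^\vee\setminus\{0\}}\Vert\xi\Vert^\vee$$ be its first minimum. The function $\beta(r):=r\,e^{-(r^2-1)/2}$ restricts to a decreasing bijection $\beta:[1,+\infty)\to(0,1]$; let $t_n:=\beta^{-1}(3^{-1/n})\in(1,+\infty)$ for the inverse of this bijection. Then $$R_{\mathrm{cov}}(\overline{E})\cdot\lambda_1(\overline{E}^\vee)\le \frac{t_n^2\,n}{2\pi}.$$ Moreover, if $n\ge 3$, then $t_n\le\sqrt{\pi}$,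 and in particular $$R_{\mathrm{cov}}(\overline{E})\cdot\lambda_1(\overline{E}^\vee)\le \frac{n}{2}.$$ -/

import Mathlib

noncomputable section

namespace EuclideanLattice

/-- The function `β(r) = r * exp(-(r² - 1)/2)`. -/
def beta (r : ℝ) : ℝ := r * Real.exp (-(r ^ 2 - 1) / 2)

theorem beta_strictAntiOn : StrictAntiOn beta (Set.Ici 1) := by
  intro a ha b _ hab
  have ha' : (1 : ℝ) ≤ a := ha
  have h1 : b ≤ a * Real.exp (b - a) := by
    have := Real.add_one_le_exp (b - a)
    nlinarith
  have h2 : Real.exp (b - a) * Real.exp (-(b ^ 2 - 1) / 2) < Real.exp (-(a ^ 2 - 1) / 2) := by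
    rw [← Real.exp_add]
    apply Real.exp_lt_exp.mpr
    nlinarith
  calc beta b ≤ a * Real.exp (b - a) * Real.exp (-(b ^ 2 - 1) / 2) :=
        mul_le_mul_of_nonneg_right h1 (Real.exp_pos _).le
    _ = a * (Real.exp (b - a) * Real.exp (-(b ^ 2 - 1) / 2)) := by ring
    _ < beta a := mul_lt_mul_of_pos_left h2 (by linarith)

/-- `β` maps `[1, +∞)` bijectively onto `(0, 1]`. -/
theorem beta_bijOn : Set.BijOn beta (Set.Ici 1) (Set.Ioc 0 1) := by
  have hone : beta 1 = 1 := by simp [beta]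
  refine ⟨fun r hr => ⟨?_, ?_⟩, beta_strictAntiOn.injOn, fun y hy => ?_⟩
  · have : (1 : ℝ) ≤ r := hr
    exact mul_pos (by linarith) (Real.exp_pos _)
  · rw [← hone]
    exact beta_strictAntiOn.antitoneOn (Set.mem_Ici.mpr le_rfl) hr hr
  · obtain ⟨hy0, hy1⟩ := hy
    have hM : (1 : ℝ) ≤ 2 / y := by rw [le_div_iff₀ hy0]; linarith
    have hMy : 2 / y * y = 2 := by field_simp
    have hle : beta (2 / y) ≤ y := by
      have h := Real.add_one_le_exp (((2 / y) ^ 2 - 1) / 2)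
      unfold beta
      rw [neg_div, Real.exp_neg, ← div_eq_mul_inv, div_le_iff₀ (Real.exp_pos _)]
      generalize 2 / y = M at *
      nlinarith
    have hc : ContinuousOn beta (Set.Icc 1 (2 / y)) := by
      unfold beta
      fun_prop
    obtain ⟨r, hr, hry⟩ := intermediate_value_Icc' hM hc ⟨hle, hy1.trans hone.ge⟩
    exact ⟨r, hr.1, hry⟩

/-- The inverse `β⁻¹ : (0, 1] → [1, +∞)` of the restriction of `β` to `[1, +∞)`. -/
def betaInv : Set.Ioc (0 : ℝ) 1 ≃ Set.Ici (1 : ℝ) :=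
  (Set.BijOn.equiv beta beta_bijOn).symm

theorem three_rpow_mem (n : ℕ) : (3 : ℝ) ^ (-1 / (n : ℝ)) ∈ Set.Ioc (0 : ℝ) 1 :=
  ⟨by positivity, Real.rpow_le_one_of_one_le_of_nonpos (by norm_num)
    (div_nonpos_of_nonpos_of_nonneg (by norm_num) n.cast_nonneg)⟩

/-- `t_n = β⁻¹(3^(-1/n))`. -/
def t (n : ℕ) : ℝ := betaInv ⟨(3 : ℝ) ^ (-1 / (n : ℝ)), three_rpow_mem n⟩

/-- The first minimum of a lattice: the smallest norm of a nonzero lattice vector. -/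
def firstMinimum {V : Type*} [NormedAddCommGroup V] (L : Submodule ℤ V) : ℝ :=
  sInf {r : ℝ | ∃ e ∈ L, e ≠ 0 ∧ ‖e‖ = r}

/-- The covering radius of a lattice: the smallest `r ≥ 0` such that the closed balls of radius `r`
centered at the lattice points cover the whole space. -/
def coveringRadius {V : Type*} [NormedAddCommGroup V] (L : Submodule ℤ V) : ℝ :=
  sInf {r : ℝ | 0 ≤ r ∧ ∀ x : V, ∃ e ∈ L, ‖x - e‖ ≤ r}

/-- The dual lattice `Hom_ℤ(L, ℤ)`, realized in the dual space `V^∨` (with its dual norm, which is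
the operator norm of `StrongDual ℝ V`) as the set of linear forms with integer values on `L`. -/
def dualLattice {V : Type*} [NormedAddCommGroup V] [NormedSpace ℝ V] (L : Submodule ℤ V) :
    Submodule ℤ (StrongDual ℝ V) where
  carrier := {ξ | ∀ v ∈ L, ∃ k : ℤ, ξ v = k}
  zero_mem' := fun _ _ => ⟨0, by simp⟩
  add_mem' := by
    intro ξ η hξ hη v hv
    obtain ⟨k, hk⟩ := hξ v hv
    obtain ⟨l, hl⟩ := hη v hv
    exact ⟨k + l, by simp [hk, hl]⟩
  smul_mem' := by
    intro c ξ hξ v hv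
    obtain ⟨k, hk⟩ := hξ v hv
    exact ⟨c * k, by simp [hk]⟩

end EuclideanLattice

end

/-! This is Banaszczyk's transference argument with Gaussian sums. Write `θ_a(u) = ∑ exp(-π a ‖u +
e‖²)` over the lattice and `X` for the dual sum at parameter `1/a` and origin. Poisson summation
(`exists_gaussian_poisson`) gives `θ_a(0) = C X` and, from `-1 ≤ cos ≤ 1`, `C (2 - X) ≤ θ_a(u) ≤ C
X`.

Suppose `u` has distance at least `r` from the lattice, all nonzero dual vectors have norm at least
`l`, and `2π r l = T² n`. Weakening the Gaussian from `a` to `a s` gains `exp(-π a r² (1 - s))` on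
vectors of norm at least `r` and costs `s^(-n/2)` by Poisson. With `a = l / r` and `s = 1 / T²` the
net factor is `q = β(T)^n` on both sides: `θ_a(u) ≤ q C X` and `X - 1 ≤ q X`. Hence `2 - X ≤ q X`
and `(1 - q) X ≤ 1`, which force `q ≥ 1/3` (`not_forall_le_norm`). Since `β(t_n)^n = 1/3`, no `T >
t_n` can occur. -/

noncomputable section
open MeasureTheory UnitAddTorus
open scoped Real

namespace EuclideanLattice

/-! ### Poisson summation on `ℝ^ι` through Fourier series on the torus. -/

section

/-- The real vector with given integer coordinates. -/
def intVec {ι : Type*} (k : ι → ℤ) : ι → ℝ := fun i => (k i : ℝ)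

variable {ι : Type*}

theorem intVec_add (k l : ι → ℤ) : intVec (k + l) = intVec k + intVec l := by
  ext i; simp [intVec]

theorem intVec_injective : Function.Injective (intVec (ι := ι)) := by
  intro k l h
  ext i
  simpa [intVec] using congrFun h i

/-- The covering map from `ℝ^ι` to the unit torus. -/
def toTorus (x : ι → ℝ) : UnitAddTorus ι := fun i => (x i : UnitAddCircle)

theorem isOpenQuotientMap_toTorus : IsOpenQuotientMap (toTorus (ι := ι)) :=
  IsOpenQuotientMap.piMap fun _ => QuotientAddGroup.isOpenQuotientMap_mk

theorem exists_intVec_of_toTorus_eq {x y : ι → ℝ} (h : toTorus x = toTorus y) :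
    ∃ k : ι → ℤ, y = x + intVec k := by
  have (i : ι) : ∃ k : ℤ, y i = x i + k := by
    have hi : (x i : UnitAddCircle) = y i := congrFun h i
    rw [QuotientAddGroup.eq] at hi
    obtain ⟨k, hk⟩ := AddSubgroup.mem_zmultiples_iff.mp hi
    exact ⟨k, by simp at hk; linarith⟩
  choose k hk using this
  exact ⟨k, funext hk⟩

theorem tsum_translates_periodic (f : (ι → ℝ) → ℂ) (x : ι → ℝ) (l : ι → ℤ) :
    ∑' k : ι → ℤ, f (x + intVec l + intVec k) = ∑' k : ι → ℤ, f (x + intVec k) := by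
  rw [← (Equiv.addLeft l).tsum_eq (fun k => f (x + intVec k))]
  simp [intVec_add, add_assoc]

/-- The periodization of a function, as a function on the torus. -/
def periodize (f : (ι → ℝ) → ℂ) (θ : UnitAddTorus ι) : ℂ :=
  ∑' k : ι → ℤ, f (Function.surjInv isOpenQuotientMap_toTorus.surjective θ + intVec k)

/-- The lift chosen in `periodize` is immaterial: two lifts differ by an integer vector, which only
reindexes the sum. -/
theorem periodize_toTorus (f : (ι → ℝ) → ℂ) (x : ι → ℝ) :
    periodize f (toTorus x) = ∑' k : ι → ℤ, f (x + intVec k) := by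
  obtain ⟨l, hl⟩ := exists_intVec_of_toTorus_eq
    (Function.surjInv_eq isOpenQuotientMap_toTorus.surjective (toTorus x)).symm
  rw [periodize, hl, tsum_translates_periodic]

variable [Fintype ι]

theorem mFourier_toTorus (m : ι → ℤ) (x : ι → ℝ) :
    mFourier m (toTorus x) = Complex.exp (2 * π * Complex.I * (∑ i, m i * x i : ℝ)) := by
  simp only [mFourier, ContinuousMap.coe_mk, toTorus, fourier_coe_apply, ← Complex.exp_sum]
  congr 1
  push_cast
  rw [Finset.mul_sum]
  refine Finset.sum_congr rfl fun i _ => ?_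
  ring

theorem mFourier_toTorus_add_intVec (m k : ι → ℤ) (x : ι → ℝ) :
    mFourier m (toTorus (x + intVec k)) = mFourier m (toTorus x) := by
  congr 1
  ext i
  simp [toTorus, intVec]

/-- The half-open unit cube. -/
def unitCube (ι : Type*) : Set (ι → ℝ) := {x | ∀ i, x i ∈ Set.Ioc (0 : ℝ) (0 + 1)}

theorem measurableSet_unitCube : MeasurableSet (unitCube ι) :=
  MeasurableSet.univ_pi' fun _ => measurableSet_Ioc

theorem norm_le_one_of_mem_unitCube {x : ι → ℝ} (hx : x ∈ unitCube ι) : ‖x‖ ≤ 1 := by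
  rw [pi_norm_le_iff_of_nonneg zero_le_one]
  intro i
  have := hx i
  rw [Real.norm_eq_abs, abs_le]
  constructor <;> linarith [this.1, this.2]

/-- The integer translates of the half-open cube tile the space. -/
theorem hasSum_setIntegral_unitCube {f : (ι → ℝ) → ℂ} (hf : Integrable f) :
    HasSum (fun k : ι → ℤ => ∫ x in unitCube ι, f (x + intVec k)) (∫ x, f x) := by
  set S : (ι → ℤ) → Set (ι → ℝ) := fun k => (fun x => x - intVec k) ⁻¹' unitCube ι
  have hS : ∀ k, MeasurableSet (S k) := fun k =>
    (measurable_id.sub_const _) measurableSet_unitCube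
  have hdisj : Pairwise (Function.onFun Disjoint S) := by
    intro k l hkl
    rw [Function.onFun, Set.disjoint_left]
    intro x hk hl
    refine hkl (funext fun i => ?_)
    have h1 := hk i
    have h2 := hl i
    simp only [Pi.sub_apply, intVec, Set.mem_Ioc, zero_add] at h1 h2
    have h3 : (k i : ℝ) < l i + 1 := by linarith
    have h4 : (l i : ℝ) < k i + 1 := by linarith
    norm_cast at h3 h4
    omega
  have hunion : ⋃ k, S k = Set.univ := by
    -- The cube is open at 0 and closed at 1, so the tile containing `x` has index `⌈x i⌉ - 1`
    -- rather than the floor.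
    refine Set.eq_univ_of_forall fun x => Set.mem_iUnion.mpr ⟨fun i => ⌈x i⌉ - 1, fun i => ?_⟩
    have h1 := Int.le_ceil (x i)
    have h2 := Int.ceil_lt_add_one (x i)
    simp only [Pi.sub_apply, intVec, Set.mem_Ioc, zero_add]
    push_cast
    constructor <;> linarith
  have := hasSum_integral_iUnion hS hdisj (μ := volume) (f := f) hf.integrableOn
  rw [hunion, setIntegral_univ] at this
  rw [show (fun k : ι → ℤ => ∫ x in unitCube ι, f (x + intVec k)) =
    fun k => ∫ x in S k, f x from funext fun k => ?_]
  · exact this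
  have hp : MeasurePreserving (fun x : ι → ℝ => x + intVec k) volume volume :=
    measurePreserving_add_right _ _
  rw [← hp.setIntegral_preimage_emb (measurableEmbedding_addRight _) f (S k)]
  congr 2
  ext x
  simp [S]

/-- Locally uniform summability of the integer translates of a function. -/
def TranslatesSummable (f : (ι → ℝ) → ℂ) : Prop :=
  ∀ R : ℝ, ∃ B : (ι → ℤ) → ℝ, Summable B ∧ ∀ k x, ‖x‖ ≤ R → ‖f (x + intVec k)‖ ≤ B k

theorem TranslatesSummable.continuous_tsum {f : (ι → ℝ) → ℂ} (h : TranslatesSummable f)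
    (hf : Continuous f) : Continuous fun x => ∑' k : ι → ℤ, f (x + intVec k) := by
  refine continuous_iff_continuousAt.mpr fun x => ?_
  obtain ⟨B, hB, hle⟩ := h (‖x‖ + 1)
  refine ContinuousOn.continuousAt (s := Metric.ball x 1) ?_ (Metric.ball_mem_nhds x one_pos)
  refine continuousOn_tsum (fun k => (by fun_prop)) hB fun k y hy => hle k y ?_
  have h1 := norm_sub_norm_le y x
  have h2 := mem_ball_iff_norm.mp hy
  linarith

theorem TranslatesSummable.continuous_periodize {f : (ι → ℝ) → ℂ} (h : TranslatesSummable f)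
    (hf : Continuous f) : Continuous (periodize f) := by
  rw [isOpenQuotientMap_toTorus.isQuotientMap.continuous_iff]
  exact (h.continuous_tsum hf).congr fun x => (periodize_toTorus f x).symm

/-- Unfolding: characters are invariant under integer translation, so the sum over translates and
the integral over the cube merge into one integral over the whole space. The bound `B` on the cube
justifies the interchange. -/
theorem TranslatesSummable.mFourierCoeff_periodize {f : (ι → ℝ) → ℂ} (h : TranslatesSummable f)
    (hint : Integrable f) (m : ι → ℤ) :
    mFourierCoeff (periodize f) m = ∫ x, mFourier (-m) (toTorus x) * f x := by
  rw [mFourierCoeff_eq_integral _ _ 0]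
  change ∫ x in unitCube ι, mFourier (-m) (toTorus x) • periodize f (toTorus x) = _
  have hcont : Continuous fun x : ι → ℝ => mFourier (-m) (toTorus x) :=
    (mFourier (-m)).continuous.comp isOpenQuotientMap_toTorus.continuous
  have hnorm (x : ι → ℝ) : ‖mFourier (-m) (toTorus x)‖ ≤ 1 :=
    ((mFourier (-m)).norm_coe_le_norm _).trans mFourier_norm.le
  have hint' : Integrable fun x => mFourier (-m) (toTorus x) * f x :=
    hint.bdd_mul hcont.aestronglyMeasurable (Filter.Eventually.of_forall hnorm)
  rw [← (hasSum_setIntegral_unitCube hint').tsum_eq]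
  obtain ⟨B, hB, hle⟩ := h 1
  have hvol : volume (unitCube ι) < ⊤ :=
    lt_of_le_of_lt (measure_mono fun x hx => mem_closedBall_zero_iff.mpr
      (norm_le_one_of_mem_unitCube hx)) measure_closedBall_lt_top
  have hbd (k : ι → ℤ) (x : ι → ℝ) (hx : x ∈ unitCube ι) :
      ‖mFourier (-m) (toTorus (x + intVec k)) * f (x + intVec k)‖ ≤ B k := by
    rw [norm_mul]
    exact (mul_le_of_le_one_left (norm_nonneg _) (hnorm _)).trans
      (hle k x (norm_le_one_of_mem_unitCube hx))
  have hI (k : ι → ℤ) : Integrable (fun x => mFourier (-m) (toTorus (x + intVec k)) *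
      f (x + intVec k)) (volume.restrict (unitCube ι)) :=
    (hint'.comp_add_right (intVec k)).integrableOn
  rw [integral_tsum_of_summable_integral_norm hI]
  · refine setIntegral_congr_fun measurableSet_unitCube fun x _ => ?_
    simp only [periodize_toTorus, smul_eq_mul, mFourier_toTorus_add_intVec, tsum_mul_left]
  · refine Summable.of_nonneg_of_le (fun k => integral_nonneg fun x => norm_nonneg _)
      (fun k => ?_) (hB.mul_right (volume.real (unitCube ι)))
    refine (setIntegral_mono_on (hI k).norm
      (integrableOn_const hvol.ne) measurableSet_unitCube (hbd k)).trans ?_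
    simp [mul_comm]

/-- **Poisson summation** on `ℝ^ι` for functions with locally uniformly summable translates. -/
theorem TranslatesSummable.hasSum_poisson {f : (ι → ℝ) → ℂ} (h : TranslatesSummable f)
    (hf : Continuous f) (hint : Integrable f)
    (hsum : Summable fun m : ι → ℤ => ∫ x, mFourier (-m) (toTorus x) * f x) (x : ι → ℝ) :
    HasSum (fun m : ι → ℤ => (∫ y, mFourier (-m) (toTorus y) * f y) * mFourier m (toTorus x))
      (∑' k : ι → ℤ, f (x + intVec k)) := by
  let F : C(UnitAddTorus ι, ℂ) := ⟨periodize f, h.continuous_periodize hf⟩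
  have hcoeff : mFourierCoeff F = fun m => ∫ x, mFourier (-m) (toTorus x) * f x :=
    funext (h.mFourierCoeff_periodize hint)
  have := hasSum_mFourier_series_apply_of_summable (f := F) (hcoeff ▸ hsum) (toTorus x)
  rw [hcoeff] at this
  simpa only [F, ContinuousMap.coe_mk, periodize_toTorus, smul_eq_mul] using this

end

/-! ### Summability of Gaussians and Poisson summation for a lattice. -/

section

/-- A translation is absorbed at the price of halving the exponent, by `‖v‖² ≤ 2‖u + v‖² + 2‖u‖²`.
-/
theorem exp_neg_norm_add_sq_le {E : Type*} [NormedAddCommGroup E] {c : ℝ} (hc : 0 ≤ c) (u v : E) :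
    Real.exp (-c * ‖u + v‖ ^ 2) ≤
      Real.exp (c * ‖u‖ ^ 2) * Real.exp (-(c / 2) * ‖v‖ ^ 2) := by
  rw [← Real.exp_add]
  refine Real.exp_le_exp.mpr ?_
  have h1 : ‖v‖ ≤ ‖u + v‖ + ‖u‖ := by
    simpa using norm_sub_le (u + v) u
  have h2 : ‖v‖ ^ 2 ≤ 2 * ‖u + v‖ ^ 2 + 2 * ‖u‖ ^ 2 := by
    nlinarith [norm_nonneg v, norm_nonneg (u + v), norm_nonneg u,
      sq_nonneg (‖u + v‖ - ‖u‖)]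
  nlinarith

theorem exp_neg_sq_le {c x : ℝ} (hc : 0 < c) (hx : 0 < x) (N : ℕ) :
    Real.exp (-c * x ^ 2) ≤ N.factorial / c ^ N * x⁻¹ ^ (2 * N) := by
  have := Real.pow_div_factorial_le_exp (x := c * x ^ 2) (by positivity) N
  have hN : (0 : ℝ) < N.factorial := by positivity
  rw [neg_mul, Real.exp_neg]
  refine (inv_anti₀ (by positivity) this).trans_eq ?_
  rw [mul_pow, ← pow_mul, inv_pow]
  field_simp

theorem cexp_gaussian (a r : ℝ) :
    Complex.exp (-(π * a : ℝ) * r ^ 2) = (Real.exp (-(π * a) * r ^ 2) : ℝ) := by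
  push_cast; rfl

variable {ι : Type*} [Fintype ι]

section Summability

variable {E : Type*} [NormedAddCommGroup E] [NormedSpace ℝ E]

/-- The integer combination of the basis `b` with coefficients `m`. -/
def intComb (b : Module.Basis ι ℝ E) (m : ι → ℤ) : E := b.equivFun.symm (intVec m)

theorem intComb_eq_sum (b : Module.Basis ι ℝ E) (m : ι → ℤ) :
    intComb b m = ∑ i, m i • b i := by
  simp [intComb, intVec, Module.Basis.equivFun_symm_apply, Int.cast_smul_eq_zsmul]

theorem intComb_injective (b : Module.Basis ι ℝ E) : Function.Injective (intComb b) :=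
  b.equivFun.symm.injective.comp intVec_injective

theorem intComb_zero (b : Module.Basis ι ℝ E) : intComb b 0 = 0 := by
  simp [intComb_eq_sum]

theorem intComb_mem_span (b : Module.Basis ι ℝ E) (m : ι → ℤ) :
    intComb b m ∈ Submodule.span ℤ (Set.range b) := by
  rw [intComb_eq_sum]
  exact Submodule.sum_mem _ fun i _ =>
    Submodule.smul_mem _ _ (Submodule.subset_span (Set.mem_range_self i))

theorem summable_gaussian_lattice [FiniteDimensional ℝ E] (L : Submodule ℤ E) [DiscreteTopology L]
    {c : ℝ} (hc : 0 < c) : Summable fun z : L => Real.exp (-c * ‖(z : E)‖ ^ 2) := by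
  obtain ⟨N, hN⟩ : ∃ N : ℕ, Module.finrank ℤ L < 2 * N :=
    ⟨Module.finrank ℤ L + 1, by omega⟩
  have h1 : Summable fun z : L => ‖z‖⁻¹ ^ (2 * N) := ZLattice.summable_norm_pow_inv L (2 * N) hN
  refine Summable.of_norm_bounded_eventually (h1.mul_left (N.factorial / c ^ N)) ?_
  refine (Set.finite_singleton (0 : L)).eventually_cofinite_notMem.mono fun z hz => ?_
  rw [Real.norm_of_nonneg (Real.exp_nonneg _)]
  exact exp_neg_sq_le hc (norm_pos_iff.mpr hz) N

theorem summable_gaussian (b : Module.Basis ι ℝ E) {c : ℝ} (hc : 0 < c) :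
    Summable fun m : ι → ℤ => Real.exp (-c * ‖intComb b m‖ ^ 2) := by
  have : FiniteDimensional ℝ E := b.finiteDimensional_of_finite
  let φ : (ι → ℤ) → Submodule.span ℤ (Set.range b) := fun m => ⟨intComb b m, intComb_mem_span b m⟩
  have hφ : Function.Injective φ :=
    fun k l h => intComb_injective b (congrArg Subtype.val h)
  have h := summable_gaussian_lattice (Submodule.span ℤ (Set.range b)) hc
  have h' := h.comp_injective hφ
  exact h'

theorem summable_gaussian_translate (b : Module.Basis ι ℝ E) {c : ℝ} (hc : 0 < c) (u : E) :
    Summable fun m : ι → ℤ => Real.exp (-c * ‖u + intComb b m‖ ^ 2) :=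
  Summable.of_nonneg_of_le (fun _ => Real.exp_nonneg _)
    (fun m => exp_neg_norm_add_sq_le hc.le u (intComb b m))
    ((summable_gaussian b (half_pos hc)).mul_left _)

theorem translatesSummable_gaussian (b : Module.Basis ι ℝ E) {a : ℝ} (ha : 0 < a) :
    TranslatesSummable fun x => Complex.exp (-(π * a : ℝ) * ‖b.equivFun.symm x‖ ^ 2) := by
  intro R
  have hc : 0 < π * a := by positivity
  let T : (ι → ℝ) →L[ℝ] E := (b.equivFunL.symm : (ι → ℝ) →L[ℝ] E)
  have hT : ∀ x, T x = b.equivFun.symm x := fun x => rfl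
  refine ⟨fun k => Real.exp (π * a * (‖T‖ * R) ^ 2) *
    Real.exp (-(π * a / 2) * ‖intComb b k‖ ^ 2),
    (summable_gaussian b (half_pos hc)).mul_left _, fun k x hx => ?_⟩
  dsimp only
  rw [cexp_gaussian, Complex.norm_real, Real.norm_of_nonneg (Real.exp_nonneg _), map_add]
  refine (exp_neg_norm_add_sq_le hc.le _ _).trans ?_
  refine mul_le_mul_of_nonneg_right (Real.exp_le_exp.mpr ?_) (Real.exp_nonneg _)
  have : ‖b.equivFun.symm x‖ ≤ ‖T‖ * R := by
    rw [← hT]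
    exact (T.le_opNorm x).trans (by gcongr)
  gcongr

end Summability

variable {V : Type*} [NormedAddCommGroup V] [InnerProductSpace ℝ V] [FiniteDimensional ℝ V]

/-- The basis of the normed dual which is dual to `b`. -/
def dualBasis [DecidableEq ι] (b : Module.Basis ι ℝ V) : Module.Basis ι ℝ (StrongDual ℝ V) :=
  b.dualBasis.map LinearMap.toContinuousLinearMap

theorem intComb_dualBasis_apply [DecidableEq ι] (b : Module.Basis ι ℝ V) (m : ι → ℤ) (v : V) :
    intComb (dualBasis b) m v = ∑ i, m i * b.equivFun v i := by
  simp [intComb_eq_sum, dualBasis]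

/-- Uniqueness of Haar measure. Only the positivity of `c` and its independence of `g` are used
later. -/
theorem exists_integral_comp_equivFun_symm [MeasurableSpace V] [BorelSpace V]
    (b : Module.Basis ι ℝ V) : ∃ c : ℝ, 0 < c ∧ ∀ g : V → ℂ, Integrable g →
      Integrable (fun x => g (b.equivFun.symm x)) ∧
        ∫ x, g (b.equivFun.symm x) = c * ∫ v, g v := by
  let T : (ι → ℝ) ≃L[ℝ] V := b.equivFunL.symm
  have hT : ∀ x, T x = b.equivFun.symm x := fun x => rfl
  let μ : Measure V := (volume : Measure (ι → ℝ)).map T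
  have hemb : MeasurableEmbedding T := T.toHomeomorph.measurableEmbedding
  obtain ⟨k, hk, hμ⟩ : ∃ k : NNReal, 0 < k ∧ μ = k • (volume : Measure V) :=
    ⟨μ.addHaarScalarFactor volume,
      Measure.addHaarScalarFactor_pos_of_isAddHaarMeasure μ volume,
      Measure.isAddLeftInvariant_eq_smul _ _⟩
  refine ⟨k, hk, fun g hg => ⟨?_, ?_⟩⟩
  · have : Integrable g μ := by
      rw [hμ]
      exact hg.smul_measure_nnreal
    exact (hemb.integrable_map_iff).mp this
  · have : ∫ v, g v ∂μ = ∫ x, g (T x) := hemb.integral_map g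
    simp only [← hT]
    rw [← this, hμ, integral_smul_nnreal_measure]
    rfl

/-- **Poisson summation** for Gaussian sums over translates of a lattice. -/
theorem exists_gaussian_poisson [DecidableEq ι] (b : Module.Basis ι ℝ V) :
    ∃ c : ℝ, 0 < c ∧ ∀ (a : ℝ), 0 < a → ∀ u : V,
      HasSum (fun m : ι → ℤ => ((c * (1 / a) ^ (Fintype.card ι / 2 : ℝ) *
          Real.exp (-(π * (1 / a)) * ‖intComb (dualBasis b) m‖ ^ 2) : ℝ) : ℂ) *
          Complex.exp (2 * π * Complex.I * (intComb (dualBasis b) m u : ℝ)))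
        ((∑' m : ι → ℤ, Real.exp (-(π * a) * ‖u + intComb b m‖ ^ 2) : ℝ) : ℂ) := by
  borelize V
  obtain ⟨c, hc, H⟩ := exists_integral_comp_equivFun_symm b
  refine ⟨c, hc, fun a ha u => ?_⟩
  have hπa : 0 < π * a := by positivity
  have hre : 0 < (((π * a : ℝ) : ℂ)).re := by simpa using hπa
  set f : (ι → ℝ) → ℂ := fun x => Complex.exp (-(π * a : ℝ) * ‖b.equivFun.symm x‖ ^ 2) with hf
  have hcont : Continuous f := by
    have : Continuous b.equivFun.symm := b.equivFunL.symm.continuous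
    fun_prop
  have hint : Integrable f := by
    refine (H (fun v => Complex.exp (-(π * a : ℝ) * ‖v‖ ^ 2)) ?_).1
    simpa using GaussianFourier.integrable_cexp_neg_mul_sq_norm_add hre 0 (0 : V)
  have hcoeff (m : ι → ℤ) : ∫ x, mFourier (-m) (toTorus x) * f x =
      ((c * (1 / a) ^ (Fintype.card ι / 2 : ℝ) *
          Real.exp (-(π * (1 / a)) * ‖intComb (dualBasis b) m‖ ^ 2) : ℝ) : ℂ) := by
    set ξ := intComb (dualBasis b) m
    -- The Riesz representative of `ξ` turns the character into an inner product, as in the Fourier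
    -- transform of the Gaussian.
    set w : V := (InnerProductSpace.toDual ℝ V).symm ξ
    have hw : ‖w‖ = ‖ξ‖ := LinearIsometryEquiv.norm_map _ _
    have hG := GaussianFourier.integrable_cexp_neg_mul_sq_norm_add hre (-(2 * π * Complex.I)) w
    have hG' := GaussianFourier.integral_cexp_neg_mul_sq_norm_add hre (-(2 * π * Complex.I)) w
    have h1 := (H _ hG).2
    rw [hG'] at h1
    have hn : Module.finrank ℝ V = Fintype.card ι := Module.finrank_eq_card_basis b
    have hpi : (π : ℂ) / ((π * a : ℝ) : ℂ) = ((1 / a : ℝ) : ℂ) := by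
      have : (π : ℂ) ≠ 0 := by exact_mod_cast Real.pi_ne_zero
      have : (a : ℂ) ≠ 0 := by exact_mod_cast ha.ne'
      push_cast
      field_simp
    calc _ = ∫ x, Complex.exp (-(π * a : ℝ) * ‖b.equivFun.symm x‖ ^ 2 +
            -(2 * π * Complex.I) * (inner ℝ w (b.equivFun.symm x) : ℝ)) := by
          refine integral_congr_ae (Filter.Eventually.of_forall fun x => ?_)
          simp only [hf]
          rw [mFourier_toTorus, ← Complex.exp_add, InnerProductSpace.toDual_symm_apply,
            intComb_dualBasis_apply, LinearEquiv.apply_symm_apply]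
          congr 1
          simp only [Pi.neg_apply, Int.cast_neg, neg_mul, Finset.sum_neg_distrib]
          push_cast
          ring
      _ = _ := h1
      _ = _ := by
          rw [hpi, hn, hw]
          push_cast
          rw [Complex.ofReal_cpow (by positivity), ← mul_assoc]
          push_cast
          congr 2
          have : (π : ℂ) ≠ 0 := by exact_mod_cast Real.pi_ne_zero
          have : (a : ℂ) ≠ 0 := by exact_mod_cast ha.ne'
          field_simp
          rw [Complex.I_sq]
          ring
  have hsum : Summable fun m : ι → ℤ => ∫ x, mFourier (-m) (toTorus x) * f x := by
    simp only [hcoeff]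
    refine Complex.summable_ofReal.mpr (Summable.mul_left _ ?_)
    exact summable_gaussian (dualBasis b) (by positivity)
  have := (show TranslatesSummable f from translatesSummable_gaussian b ha).hasSum_poisson hcont hint hsum (b.equivFun u)
  simp only [hcoeff] at this
  simp only [mFourier_toTorus, ← intComb_dualBasis_apply] at this
  convert this using 1
  rw [Complex.ofReal_tsum]
  refine tsum_congr fun m => ?_
  simp only [hf, map_add, LinearEquiv.symm_apply_apply]
  rw [cexp_gaussian]
  rfl

end

/-! ### Gaussian sums of a lattice and its dual; the transference inequality. -/

section

variable {ι : Type*} [Fintype ι]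

section GaussianSum

variable {E : Type*} [NormedAddCommGroup E] [NormedSpace ℝ E] (b : Module.Basis ι ℝ E)

/-- The sum of the Gaussian `exp (-π a ‖·‖²)` over the translate by `u` of the lattice spanned
by `b`. -/
def gaussianSum (a : ℝ) (u : E) : ℝ :=
  ∑' m : ι → ℤ, Real.exp (-(π * a) * ‖u + intComb b m‖ ^ 2)

theorem hasSum_gaussianSum {a : ℝ} (ha : 0 < a) (u : E) :
    HasSum (fun m : ι → ℤ => Real.exp (-(π * a) * ‖u + intComb b m‖ ^ 2)) (gaussianSum b a u) :=
  (summable_gaussian_translate b (by positivity) u).hasSum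

theorem hasSum_gaussianSum_zero {a : ℝ} (ha : 0 < a) :
    HasSum (fun m : ι → ℤ => Real.exp (-(π * a) * ‖intComb b m‖ ^ 2)) (gaussianSum b a 0) := by
  simpa using hasSum_gaussianSum b ha 0

theorem hasSum_origin : HasSum (fun m : ι → ℤ => if m = 0 then (1 : ℝ) else 0) 1 := by
  classical
  exact hasSum_ite_eq 0 1

theorem gaussianSum_antitone {a a' : ℝ} (ha : 0 < a) (h : a ≤ a') (u : E) :
    gaussianSum b a' u ≤ gaussianSum b a u := by
  refine hasSum_le (fun m => Real.exp_le_exp.mpr ?_) (hasSum_gaussianSum b (ha.trans_le h) u)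
    (hasSum_gaussianSum b ha u)
  have := mul_le_mul_of_nonneg_left h Real.pi_pos.le
  nlinarith [sq_nonneg ‖u + intComb b m‖]

theorem one_le_gaussianSum {a : ℝ} (ha : 0 < a) : 1 ≤ gaussianSum b a 0 := by
  refine hasSum_le (fun m => ?_) hasSum_origin (hasSum_gaussianSum_zero b ha)
  split_ifs with h
  · simp [h, intComb_zero]
  · exact Real.exp_nonneg _

/-- Split `a = a (1 - s) + a s` and replace `x` by `r` in the first part only. -/
theorem exp_neg_sq_le_of_le {a s r x : ℝ} (ha : 0 ≤ a) (hs1 : s ≤ 1) (hr : 0 ≤ r)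
    (h : r ≤ x) : Real.exp (-(π * a) * x ^ 2) ≤
      Real.exp (-(π * a * r ^ 2) * (1 - s)) * Real.exp (-(π * (a * s)) * x ^ 2) := by
  rw [← Real.exp_add]
  refine Real.exp_le_exp.mpr ?_
  have h2 : r ^ 2 ≤ x ^ 2 := by gcongr
  have h3 : 0 ≤ π * a * (1 - s) := by
    have := sub_nonneg.mpr hs1
    positivity
  nlinarith [mul_le_mul_of_nonneg_left h2 h3]

theorem gaussianSum_le_of_le_norm {a s r : ℝ} (ha : 0 < a) (hs : 0 < s) (hs1 : s ≤ 1)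
    (hr : 0 ≤ r) {u : E} (h : ∀ m : ι → ℤ, r ≤ ‖u + intComb b m‖) :
    gaussianSum b a u ≤ Real.exp (-(π * a * r ^ 2) * (1 - s)) * gaussianSum b (a * s) u :=
  hasSum_le (fun m => exp_neg_sq_le_of_le ha.le hs1 hr (h m)) (hasSum_gaussianSum b ha u)
    ((hasSum_gaussianSum b (mul_pos ha hs) u).mul_left _)

theorem gaussianSum_sub_one_le {a s r : ℝ} (ha : 0 < a) (hs : 0 < s) (hs1 : s ≤ 1)
    (hr : 0 ≤ r) (h : ∀ m : ι → ℤ, m ≠ 0 → r ≤ ‖intComb b m‖) :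
    gaussianSum b a 0 - 1 ≤
      Real.exp (-(π * a * r ^ 2) * (1 - s)) * gaussianSum b (a * s) 0 := by
  refine hasSum_le (fun m => ?_) ((hasSum_gaussianSum_zero b ha).sub hasSum_origin)
    ((hasSum_gaussianSum_zero b (mul_pos ha hs)).mul_left _)
  split_ifs with hm
  · rw [hm, intComb_zero]
    simpa using Real.exp_nonneg _
  · rw [sub_zero]
    exact exp_neg_sq_le_of_le ha.le hs1 hr (h m hm)

end GaussianSum

variable {V : Type*} [NormedAddCommGroup V] [InnerProductSpace ℝ V] [FiniteDimensional ℝ V]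

/-- Comparison of the Gaussian sums of a lattice and of its dual, obtained from the Poisson
summation formula. -/
theorem exists_gaussianSum_dual [DecidableEq ι] (b : Module.Basis ι ℝ V) :
    ∃ c : ℝ, 0 < c ∧ ∀ a : ℝ, 0 < a →
      gaussianSum b a 0 =
        c * (1 / a) ^ (Fintype.card ι / 2 : ℝ) * gaussianSum (dualBasis b) (1 / a) 0 ∧
      ∀ u : V,
        gaussianSum b a u ≤
          c * (1 / a) ^ (Fintype.card ι / 2 : ℝ) * gaussianSum (dualBasis b) (1 / a) 0 ∧
        c * (1 / a) ^ (Fintype.card ι / 2 : ℝ) * (2 - gaussianSum (dualBasis b) (1 / a) 0) ≤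
          gaussianSum b a u := by
  obtain ⟨c, hc, H⟩ := exists_gaussian_poisson b
  refine ⟨c, hc, fun a ha => ?_⟩
  have hC : 0 < c * (1 / a) ^ (Fintype.card ι / 2 : ℝ) := by positivity
  set C := c * (1 / a) ^ (Fintype.card ι / 2 : ℝ)
  set G : (ι → ℤ) → ℝ := fun m => Real.exp (-(π * (1 / a)) * ‖intComb (dualBasis b) m‖ ^ 2) with hG
  have hG0 : G 0 = 1 := by simp [hG, intComb_zero]
  have hGpos (m : ι → ℤ) : 0 < G m := Real.exp_pos _
  have hsum : HasSum G (gaussianSum (dualBasis b) (1 / a) 0) :=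
    hasSum_gaussianSum_zero (dualBasis b) (by positivity)
  have hcos (u : V) : HasSum (fun m => C * G m * Real.cos (2 * π * intComb (dualBasis b) m u))
      (gaussianSum b a u) := by
    have := Complex.hasSum_re (H a ha u)
    rw [Complex.ofReal_re] at this
    refine (congrArg (HasSum · _) (funext fun m => ?_)).mp this
    rw [Complex.re_ofReal_mul]
    congr 1
    rw [show 2 * π * Complex.I * (intComb (dualBasis b) m u : ℝ) =
      ((2 * π * intComb (dualBasis b) m u : ℝ) : ℂ) * Complex.I by push_cast; ring]
    exact Complex.exp_ofReal_mul_I_re _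
  refine ⟨?_, fun u => ⟨?_, ?_⟩⟩
  · have h0 := hcos 0
    simp only [map_zero, mul_zero, Real.cos_zero, mul_one] at h0
    exact h0.unique (hsum.mul_left C)
  · refine hasSum_le (fun m => ?_) (hcos u) (hsum.mul_left C)
    exact mul_le_of_le_one_right (mul_pos hC (hGpos m)).le (Real.cos_le_one _)
  · rw [← mul_one (2 : ℝ)]
    -- Termwise, `cos ≥ -1` off the origin, while the term at the origin is exactly `1 = 2 - 1`.
    refine hasSum_le (fun m => ?_) (((hasSum_origin.mul_left 2).sub hsum).mul_left C) (hcos u)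
    split_ifs with hm
    · simp [hm, hG0, intComb_zero]
      linarith
    · have := mul_le_mul_of_nonneg_left
        (Real.neg_one_le_cos (2 * π * intComb (dualBasis b) m u)) (mul_pos hC (hGpos m)).le
      linarith

theorem sq_rpow_half {x : ℝ} (hx : 0 ≤ x) (n : ℕ) : (x ^ 2) ^ (n / 2 : ℝ) = x ^ n := by
  rw [← Real.rpow_natCast x 2, ← Real.rpow_mul hx, ← Real.rpow_natCast x n]
  congr 1
  push_cast
  ring

theorem beta_pow (T : ℝ) (n : ℕ) :
    beta T ^ n = Real.exp (-((T ^ 2 - 1) * n / 2)) * T ^ n := by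
  rw [beta, mul_pow, ← Real.exp_nat_mul, mul_comm]
  congr 2
  ring

/-- A lattice translate avoiding the ball of radius `r` and a dual lattice whose nonzero vectors
have norm at least `l` cannot coexist when `r * l` is too large. -/
theorem not_forall_le_norm [DecidableEq ι] (b : Module.Basis ι ℝ V) {r l T : ℝ} (hr : 0 < r)
    (hl : 0 < l) (hT : 1 ≤ T) (hrl : 2 * π * (r * l) = T ^ 2 * Fintype.card ι)
    (hβ : beta T ^ Fintype.card ι < 1 / 3)
    (hdual : ∀ m : ι → ℤ, m ≠ 0 → l ≤ ‖intComb (dualBasis b) m‖) (u : V) :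
    ¬ ∀ m : ι → ℤ, r ≤ ‖u + intComb b m‖ := by
  intro hu
  obtain ⟨c, hc, H⟩ := exists_gaussianSum_dual b
  set n := Fintype.card ι
  have hT0 : 0 < T := by linarith
  have ha : 0 < l / r := by positivity
  -- This choice balances the two sides: `a r² = l² / a = r l`.
  set a := l / r with ha_def
  -- This `s` minimizes `exp(-π r l (1 - s)) s^(-n/2)`.
  set s := 1 / T ^ 2 with hs_def
  have hs : 0 < s := by positivity
  have hs1 : s ≤ 1 := by
    rw [hs_def, div_le_one (by positivity)]
    nlinarith
  set C := c * (1 / a) ^ (n / 2 : ℝ) with hC_def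
  have hC : 0 < C := by positivity
  set X := gaussianSum (dualBasis b) (1 / a) 0
  have hX : 1 ≤ X := one_le_gaussianSum _ (by positivity)
  set K := Real.exp (-((T ^ 2 - 1) * n / 2)) with hK_def
  have hK : 0 < K := Real.exp_pos _
  have hβK : beta T ^ n = K * T ^ n := beta_pow T n
  have hsT : T ^ 2 * (1 - s) = T ^ 2 - 1 := by rw [hs_def]; field_simp
  have hexp {κ : ℝ} (hκ : κ = π * (r * l)) : Real.exp (-κ * (1 - s)) = K := by
    rw [hK_def, ← hsT, hκ]
    congr 1
    linear_combination (-(1 - s) / 2) * hrl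
  have hK1 : Real.exp (-(π * a * r ^ 2) * (1 - s)) = K :=
    hexp (by rw [ha_def]; field_simp)
  have hK2 : Real.exp (-(π * (1 / a) * l ^ 2) * (1 - s)) = K :=
    hexp (by rw [ha_def]; field_simp)
  have hprimal : gaussianSum b a u ≤ K * T ^ n * C * X := by
    have h1 := gaussianSum_le_of_le_norm b ha hs hs1 hr.le hu
    rw [hK1] at h1
    have h2 := ((H (a * s) (by positivity)).2 u).1
    have h3 : gaussianSum (dualBasis b) (1 / (a * s)) 0 ≤ X :=
      gaussianSum_antitone _ (by positivity)
        (one_div_le_one_div_of_le (by positivity) (mul_le_of_le_one_right ha.le hs1)) 0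
    have h4 : c * (1 / (a * s)) ^ (n / 2 : ℝ) = T ^ n * C := by
      rw [hC_def, ← sq_rpow_half hT0.le n, hs_def,
        show 1 / (a * (1 / T ^ 2)) = T ^ 2 * (1 / a) by field_simp,
        Real.mul_rpow (by positivity) (by positivity)]
      ring
    rw [h4] at h2
    calc _ ≤ K * gaussianSum b (a * s) u := h1
      _ ≤ K * (T ^ n * C * X) := by
        gcongr
        exact h2.trans (by gcongr)
      _ = _ := by ring
  have hdual' : X - 1 ≤ K * T ^ n * X := by
    have h1 := gaussianSum_sub_one_le (dualBasis b) (a := 1 / a) (by positivity) hs hs1 hl.le hdual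
    rw [hK2] at h1
    have h2 := (H (a / s) (by positivity)).1
    -- Monotonicity of the primal sum, read through Poisson, bounds the growth of the dual sum when
    -- its parameter shrinks by `s`.
    have h3 : gaussianSum b (a / s) 0 ≤ gaussianSum b a 0 :=
      gaussianSum_antitone _ ha (le_div_self ha.le hs hs1) 0
    rw [(H a ha).1, h2, show 1 / (a / s) = 1 / a * s by field_simp] at h3
    have h4 : c * (1 / a) ^ (n / 2 : ℝ) = T ^ n * (c * (1 / a * s) ^ (n / 2 : ℝ)) := by
      rw [← sq_rpow_half hT0.le n, mul_left_comm,
        ← Real.mul_rpow (by positivity) (by positivity), hs_def]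
      congr 2
      field_simp
    rw [h4, mul_comm (T ^ n), mul_assoc (c * _) (T ^ n)] at h3
    have h5 := le_of_mul_le_mul_left h3 (by positivity)
    calc _ ≤ _ := h1
      _ ≤ K * (T ^ n * X) := by gcongr
      _ = _ := by ring
  have hlow := ((H a ha).2 u).2
  rw [← hβK] at hprimal hdual'
  have h6 : C * (2 - X) ≤ C * (beta T ^ n * X) := by
    refine hlow.trans (hprimal.trans_eq ?_)
    ring
  have h7 := le_of_mul_le_mul_left h6 hC
  -- With `q = β(T)^n`, `2 ≤ (1 + q) X` and `(1 - q) X ≤ 1` contradict `q < 1/3`.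
  nlinarith

/-! ### The constant `t_n` and its bound by `√π`. -/

theorem one_le_t (n : ℕ) : 1 ≤ t n := (betaInv ⟨_, three_rpow_mem n⟩).2

theorem beta_t (n : ℕ) : beta (t n) = (3 : ℝ) ^ (-1 / (n : ℝ)) :=
  congrArg Subtype.val
    ((Set.BijOn.equiv beta beta_bijOn).apply_symm_apply ⟨_, three_rpow_mem n⟩)

theorem beta_pos {r : ℝ} (hr : 0 < r) : 0 < beta r := mul_pos hr (Real.exp_pos _)

theorem beta_t_pow {n : ℕ} (hn : 0 < n) : beta (t n) ^ n = 1 / 3 := by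
  have : (n : ℝ) ≠ 0 := by positivity
  rw [beta_t, ← Real.rpow_mul_natCast (by norm_num), div_mul_cancel₀ _ this, Real.rpow_neg_one]
  norm_num

/-- As `β` decreases, it suffices that `β(√π) ≤ 3^(-1/n)`, and `n = 3` is the worst case. Sixth
powers clear both roots, leaving `9 π³ ≤ exp(3 (π - 1))`. -/
theorem t_le_sqrt_pi {n : ℕ} (hn : 3 ≤ n) : t n ≤ √π := by
  have hpi : (3.14 : ℝ) < π := Real.pi_gt_d2
  have h1 : (1 : ℝ) ≤ √π := Real.one_le_sqrt.mpr (by linarith)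
  refine (beta_strictAntiOn.le_iff_ge h1 (one_le_t n)).mp ?_
  have h3 : (3 : ℝ) ^ (-1 / (3 : ℝ)) ≤ 3 ^ (-1 / (n : ℝ)) := by
    refine Real.rpow_le_rpow_of_exponent_le (by norm_num) ?_
    have : (3 : ℝ) ≤ n := by exact_mod_cast hn
    rw [div_le_div_iff₀ (by norm_num) (by positivity)]
    linarith
  rw [beta_t]
  refine le_trans ?_ h3
  refine (pow_le_pow_iff_left₀ (beta_pos (by linarith)).le (by positivity)
    (by norm_num : 6 ≠ 0)).mp ?_
  have hsq : √π ^ 6 = π ^ 3 := by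
    rw [show √π ^ 6 = (√π ^ 2) ^ 3 by ring, Real.sq_sqrt Real.pi_pos.le]
  have hrhs : ((3 : ℝ) ^ (-1 / (3 : ℝ))) ^ 6 = 1 / 9 := by
    rw [← Real.rpow_mul_natCast (by norm_num),
      show -1 / (3 : ℝ) * (6 : ℕ) = ((-2 : ℤ) : ℝ) by norm_num, Real.rpow_intCast]
    norm_num
  have hexp : (387 : ℝ) ≤ Real.exp ((π - 1) * 6 / 2) := by
    calc (387 : ℝ) ≤ 2.7 ^ 6 := by norm_num
      _ ≤ Real.exp 1 ^ 6 := by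
        gcongr
        linarith [Real.exp_one_gt_d9]
      _ = Real.exp 6 := by rw [← Real.exp_nat_mul]; norm_num
      _ ≤ _ := Real.exp_le_exp.mpr (by linarith)
  have hpi3 : π ^ 3 ≤ 3.15 ^ 3 := by
    gcongr
    exact Real.pi_lt_d2.le
  rw [beta_pow, hsq, hrhs, Real.sq_sqrt Real.pi_pos.le, Real.exp_neg, inv_mul_eq_div,
    div_le_iff₀ (Real.exp_pos _)]
  push_cast
  norm_num at hpi3
  linarith

/-! ### From bases to the covering radius and the first minimum. -/

theorem intComb_dualBasis_mem [DecidableEq ι] {L : Submodule ℤ V} (b : Module.Basis ι ℝ V)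
    (hb : Submodule.span ℤ (Set.range b) = L) (m : ι → ℤ) :
    intComb (dualBasis b) m ∈ dualLattice L := by
  intro v hv
  rw [← hb] at hv
  induction hv using Submodule.span_induction with
  | mem x hx =>
    obtain ⟨i, rfl⟩ := hx
    exact ⟨m i, by simp [intComb_dualBasis_apply]⟩
  | zero => exact ⟨0, by simp⟩
  | add x y _ _ hx hy =>
    obtain ⟨k, hk⟩ := hx
    obtain ⟨l, hl⟩ := hy
    exact ⟨k + l, by simp [hk, hl]⟩
  | smul z x _ hx =>
    obtain ⟨k, hk⟩ := hx
    exact ⟨z * k, by simp [hk]⟩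

theorem firstMinimum_nonneg {E : Type*} [NormedAddCommGroup E] (L : Submodule ℤ E) :
    0 ≤ firstMinimum L := by
  refine Real.sInf_nonneg ?_
  rintro _ ⟨e, -, -, rfl⟩
  exact norm_nonneg e

theorem firstMinimum_le_norm {E : Type*} [NormedAddCommGroup E] {L : Submodule ℤ E} {e : E}
    (he : e ∈ L) (h0 : e ≠ 0) : firstMinimum L ≤ ‖e‖ := by
  refine csInf_le ⟨0, ?_⟩ ⟨e, he, h0, rfl⟩
  rintro _ ⟨e, -, -, rfl⟩
  exact norm_nonneg e

theorem exists_lt_norm_sub_of_lt_coveringRadius {E : Type*} [NormedAddCommGroup E]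
    {L : Submodule ℤ E} {r : ℝ} (hr : 0 ≤ r) (h : r < coveringRadius L) :
    ∃ x : E, ∀ e ∈ L, r < ‖x - e‖ := by
  by_contra! hcov
  exact h.not_ge (csInf_le ⟨0, fun _ h => h.1⟩ ⟨hr, hcov⟩)

theorem coveringRadius_mul_firstMinimum_le (L : Submodule ℤ V) [DiscreteTopology L]
    [IsZLattice ℝ L] {n : ℕ} (hn : 0 < n) (hrank : Module.finrank ℝ V = n) :
    coveringRadius L * firstMinimum (dualLattice L) ≤ t n ^ 2 * n / (2 * π) := by
  classical
  have : Module.Free ℤ L := ZLattice.module_free ℝ L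
  have : Module.Finite ℤ L := ZLattice.module_finite ℝ L
  let b := (Module.Free.chooseBasis ℤ L).ofZLatticeBasis ℝ L
  have hb : Submodule.span ℤ (Set.range b) = L :=
    (Module.Free.chooseBasis ℤ L).ofZLatticeBasis_span ℝ
  have hcard : Fintype.card (Module.Free.ChooseBasisIndex ℤ L) = n :=
    (Module.finrank_eq_card_basis b).symm.trans hrank
  have hn' : (0 : ℝ) < n := by exact_mod_cast hn
  have ht := one_le_t n
  by_contra! hlt
  set l := firstMinimum (dualLattice L)
  have hq : 0 < t n ^ 2 * n / (2 * π) := by positivity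
  have hl : 0 < l := by
    refine (firstMinimum_nonneg _).lt_of_ne fun h => ?_
    rw [show l = 0 from h.symm, mul_zero] at hlt
    exact hlt.not_gt hq
  -- Taking `r` strictly between gives both a point farther than `r` from the lattice and `T > t n`,
  -- so no infimum need be attained.
  obtain ⟨r, hr1, hr2⟩ := exists_between ((div_lt_iff₀ hl).mpr hlt)
  have hr : 0 < r := lt_trans (by positivity) hr1
  obtain ⟨x, hx⟩ := exists_lt_norm_sub_of_lt_coveringRadius hr.le hr2
  have hrl : t n ^ 2 * n < 2 * π * (r * l) := by
    rw [div_lt_iff₀ hl, div_lt_iff₀ (by positivity)] at hr1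
    linarith
  set T := √(2 * π * (r * l) / n)
  have hT2 : T ^ 2 = 2 * π * (r * l) / n := Real.sq_sqrt (by positivity)
  have htT : t n < T := by
    refine Real.lt_sqrt_of_sq_lt ?_
    rwa [lt_div_iff₀ hn']
  refine not_forall_le_norm b hr hl (ht.trans htT.le) ?_ ?_ (fun m hm => ?_) x (fun m => ?_)
  · rw [hcard, hT2]
    field_simp
  · rw [hcard, ← beta_t_pow hn]
    exact pow_lt_pow_left₀ (beta_strictAntiOn ht (ht.trans htT.le) htT)
      (beta_pos (by linarith)).le hn.ne'
  -- It is enough that integer combinations of the dual basis lie in the dual lattice; equality is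
  -- not needed.
  · refine firstMinimum_le_norm (intComb_dualBasis_mem b hb m) fun h => hm ?_
    exact intComb_injective (dualBasis b) (h.trans (intComb_zero _).symm)
  · have hmem : intComb b m ∈ L := hb.le (intComb_mem_span b m)
    simpa using (hx _ (L.neg_mem hmem)).le

end

end EuclideanLattice

end

theorem proposition3p8
    {V : Type*} [NormedAddCommGroup V] [InnerProductSpace ℝ V] [FiniteDimensional ℝ V]
    (L : Submodule ℤ V) [DiscreteTopology L] [IsZLattice ℝ L]
    (n : ℕ) (hn : 0 < n) (hrank : Module.finrank ℝ V = n) :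
    EuclideanLattice.coveringRadius L *
        EuclideanLattice.firstMinimum (EuclideanLattice.dualLattice L) ≤
      (EuclideanLattice.t n) ^ 2 * n / (2 * Real.pi) ∧
    (3 ≤ n →
      EuclideanLattice.t n ≤ Real.sqrt Real.pi ∧
      EuclideanLattice.coveringRadius L *
          EuclideanLattice.firstMinimum (EuclideanLattice.dualLattice L) ≤ (n : ℝ) / 2) := by
  have hmain := EuclideanLattice.coveringRadius_mul_firstMinimum_le L hn hrank
  refine ⟨hmain, fun h3 => ⟨EuclideanLattice.t_le_sqrt_pi h3, hmain.trans ?_⟩⟩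
  have ht := EuclideanLattice.t_le_sqrt_pi h3
  have ht2 : EuclideanLattice.t n ^ 2 ≤ Real.pi :=
    (Real.le_sqrt (by linarith [EuclideanLattice.one_le_t n]) Real.pi_pos.le).mp ht
  rw [div_le_div_iff₀ (by positivity) two_pos]
  nlinarith [mul_le_mul_of_nonneg_right ht2 (Nat.cast_nonneg (α := ℝ) n)]
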